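/- Let $k\ge 2$ be an integer and let \[ A=\{0,1\}\cup\{3,4,\dots,k-1\}\cup\{k+2\}\subseteq \mathbb{Z}_{2k} \] (where $\{3,4,\dots,k-1\}$ is empty if $k\le 3$), with complement $\complement A=\mathbb{Z}_{2k}\setminus A$. For $U,V\subseteq\mathbb{Z}_{2k}$ and $u,v\in\mathbb{Z}_{2k}$ write $U\pm V=\{x\pm y: x\in U,\ y\in V\}$, $v\cdot U=\{vx:x\in U\}$, $U+u=\{x+u:x\in U\}$ and $u-U=\{u-x:x\in U\}$. 1. $A-\complement A=\mathbb{Z}_{2k}\setminus\{0\}$. 2. For every unit $v\in\mathbb{Z}_{2k}^{\times}$: if $A+v\cdot\complement A\ne\mathbb{Z}_{2k}$, then there is $u\in\mathbb{Z}_{2k}$ with $v\cdot\complement A=u-\complement A$. 3. If $k\ge 8$, then $-v\cdot A+u\neq A$ for every unit $v\in\mathbb{Z}_{2k}^{\times}\setminus\{-1\}$ and every $u\in\mathbb{Z}_{2k}$; moreover, $A$ is a counterpoint dichotomy. That is, among the bijections $\mathbb{Z}_{2k}\to\mathbb{Z}_{2k}$ of the form $x\mapsto vx+u$ with $u,v\in\mathbb{Z}_{2k}$,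 only the identity maps $A$ onto itself, and there is exactly one such bijection $p$ with $A\cup p(A)=\mathbb{Z}_{2k}$. -/

import Mathlib

open scoped Pointwise

/-- The set `A = {0, 1} ∪ {3, 4, …, k - 1} ∪ {k + 2}` of residues modulo `2 k`. -/
def intervalSet (k : ℕ) : Set (ZMod (2 * k)) :=
  (fun n : ℕ => (n : ZMod (2 * k))) '' ({0, 1} ∪ Set.Ico 3 k ∪ {k + 2})

/-- The bijections of `ℤ/nℤ` onto itself of the affine form `e^u.v : x ↦ v x + u`. -/
def affineBijections (n : ℕ) : Set (Equiv.Perm (ZMod n)) :=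
  {g | ∃ u v : ZMod n, ∀ x, g x = v * x + u}

/-- `A ⊆ ℤ/nℤ` is a counterpoint dichotomy: the identity is the only affine bijection that maps
`A` onto itself, and exactly one affine bijection `p` (the polarity of `A`) satisfies
`A ∪ p(A) = ℤ/nℤ`. -/
def IsCounterpointDichotomy {n : ℕ} (A : Set (ZMod n)) : Prop :=
  (∀ g ∈ affineBijections n, g ≠ 1 → g '' A ≠ A) ∧
    ∃! p : Equiv.Perm (ZMod n), p ∈ affineBijections n ∧ A ∪ p '' A = Set.univ

/-! The half-turn `x ↦ x + k` exchanges `A` and its complement, so both have `k` elements. Claim 1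
says that no nonzero translation maps `A` into itself; claim 2 is a cardinality count. Claim 3 rests
on `affine_rigidity`. As `A` consists of three cyclic runs, `+1` leaves `A` from three points only,
so a symmetry `x ↦ w x + u` forces `+w` to do the same. Steps of length 5 to `k - 1` leave `A` from
at least four points and units are odd, hence `w` is `±1` or `±3`. Squaring excludes `±3`; the
isolated point `k + 2` settles `±1`. -/

/-- Two periods are covered so that sums of two reduced residues need no reduction and `omega` can
decide membership. -/
theorem natCast_mem_intervalSet {k m : ℕ} (hk : 2 ≤ k) (hm : m < 4 * k) :
    (m : ZMod (2 * k)) ∈ intervalSet k ↔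
      (m = 0 ∨ m = 1 ∨ (3 ≤ m ∧ m < k) ∨ m = k + 2) ∨
      (m = 2 * k ∨ m = 2 * k + 1 ∨ (2 * k + 3 ≤ m ∧ m < 3 * k) ∨ m = 3 * k + 2) := by
  have key : ∀ n : ℕ, n < 4 * k → ((n : ZMod (2 * k)) = m ↔
      n = m ∨ n = m + 2 * k ∨ m = n + 2 * k) := by
    have wlog_le : ∀ a b : ℕ, a ≤ b → b < 4 * k →
        ((a : ZMod (2 * k)) = b ↔ b = a ∨ b = a + 2 * k) := by
      intro a b hab hb
      rw [ZMod.natCast_eq_natCast_iff, Nat.modEq_iff_dvd' hab]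
      constructor
      · rintro ⟨c, hc⟩
        have hc2 : c < 2 := by
          by_contra! h
          have := Nat.mul_le_mul_left (2 * k) h
          omega
        interval_cases c <;> omega
      · rintro (h | h)
        · exact ⟨0, by omega⟩
        · exact ⟨1, by omega⟩
    intro n hn
    rcases le_total n m with h | h
    · rw [wlog_le n m h hm]; omega
    · rw [eq_comm, wlog_le m n h hn]; omega
  simp only [intervalSet, Set.mem_image, Set.mem_union, Set.mem_insert_iff,
    Set.mem_singleton_iff, Set.mem_Ico]
  constructor
  · rintro ⟨n, hn, h⟩
    rw [key n (by omega)] at h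
    omega
  · rintro (h | h)
    · exact ⟨m, by omega, rfl⟩
    · exact ⟨m - 2 * k, by omega, (key _ (by omega)).2 (by omega)⟩

theorem exists_natCast_lt {n : ℕ} (hn : n ≠ 0) (x : ZMod n) : ∃ m : ℕ, m < n ∧ (m : ZMod n) = x := by
  have : NeZero n := ⟨hn⟩
  exact ⟨x.val, x.val_lt, ZMod.natCast_zmod_val x⟩

theorem natCast_two_mul_eq_zero (k : ℕ) : (2 : ZMod (2 * k)) * k = 0 := by
  have := ZMod.natCast_self (2 * k)
  push_cast at this
  exact this

theorem natCast_inj_of_lt {n a b : ℕ} (ha : a < n) (hb : b < n)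
    (h : (a : ZMod n) = b) : a = b := by
  rw [ZMod.natCast_eq_natCast_iff', Nat.mod_eq_of_lt ha, Nat.mod_eq_of_lt hb] at h
  exact h

theorem natCast_sub_mem_intervalSet {k m t : ℕ} (ht : t ≤ 2 * k) :
    (m : ZMod (2 * k)) - t ∈ intervalSet k ↔
      ((m + (2 * k - t) : ℕ) : ZMod (2 * k)) ∈ intervalSet k := by
  have h2 := natCast_two_mul_eq_zero k
  rw [show (m : ZMod (2 * k)) - t = ((m + (2 * k - t) : ℕ) : ZMod (2 * k)) by
    push_cast [ht]; linear_combination -h2]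

/-! ### The half-turn, translations and the difference set. -/

theorem add_half_mem_intervalSet {k : ℕ} (hk : 2 ≤ k) (x : ZMod (2 * k)) :
    x + k ∈ intervalSet k ↔ x ∉ intervalSet k := by
  obtain ⟨m, hm, rfl⟩ := exists_natCast_lt (by omega) x
  rw [← Nat.cast_add, natCast_mem_intervalSet hk (by omega),
    natCast_mem_intervalSet hk (by omega)]
  omega

theorem image_add_half_intervalSet {k : ℕ} (hk : 2 ≤ k) :
    (fun x => x + (k : ZMod (2 * k))) '' intervalSet k = (intervalSet k)ᶜ := by
  have h2 := natCast_two_mul_eq_zero k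
  ext y
  rw [Set.mem_image, Set.mem_compl_iff, ← add_half_mem_intervalSet hk]
  constructor
  · rintro ⟨x, hx, rfl⟩
    rwa [show x + (k : ZMod (2 * k)) + k = x by linear_combination h2]
  · intro h
    exact ⟨y + k, h, by linear_combination h2⟩

theorem ncard_compl_intervalSet {k : ℕ} (hk : 2 ≤ k) :
    (intervalSet k)ᶜ.ncard = (intervalSet k).ncard := by
  rw [← image_add_half_intervalSet hk]
  exact Set.ncard_image_of_injective _ (add_left_injective _)

/-- No nonzero translation by a residue in `[1, k]` maps `A` into itself. -/
theorem exists_add_natCast_notMem {k t : ℕ} (hk : 2 ≤ k) (ht : 1 ≤ t) (htk : t ≤ k) :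
    ∃ x ∈ intervalSet k, x + t ∉ intervalSet k := by
  have main : ∃ m : ℕ, m < 2 * k ∧ (m : ZMod (2 * k)) ∈ intervalSet k ∧
      ((m + t : ℕ) : ZMod (2 * k)) ∉ intervalSet k := by
    by_contra! H
    have H' : ∀ m : ℕ, m < 2 * k → _ := fun m hm h1 => by
      have := H m hm ((natCast_mem_intervalSet hk (by omega)).2 h1)
      rwa [natCast_mem_intervalSet hk (by omega)] at this
    -- 0 and 1 leave only `3 ≤ t ≤ k - 2`; then `k - 1` forces `t = 3`, and `k - 2` moves to `k +
    -- 1`, outside `A`.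
    have h0 := H' 0 (by omega)
    have h1 := H' 1 (by omega)
    have h2 := H' (k - 1) (by omega)
    have h3 := H' (k - 2) (by omega)
    omega
  obtain ⟨m, -, h, h'⟩ := main
  exact ⟨m, h, by push_cast at h'; exact h'⟩

theorem exists_add_notMem {k : ℕ} (hk : 2 ≤ k) {d : ZMod (2 * k)} (hd : d ≠ 0) :
    ∃ x ∈ intervalSet k, x + d ∉ intervalSet k := by
  have h2 := natCast_two_mul_eq_zero k
  obtain ⟨t, ht, rfl⟩ := exists_natCast_lt (by omega) d
  have ht0 : t ≠ 0 := by rintro rfl; simp at hd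
  rcases le_or_gt t k with h | h
  · exact exists_add_natCast_notMem hk (by omega) h
  -- If `-t` moves `x` out of `A`, then `+t` moves `x - t + k` out of `A`, by the half-turn.
  · obtain ⟨x, hx, hx'⟩ := exists_add_natCast_notMem (t := 2 * k - t) hk (by omega) (by omega)
    have e : x + ((2 * k - t : ℕ) : ZMod (2 * k)) + k + t = x + k := by
      push_cast [ht.le]; linear_combination h2
    refine ⟨x + ((2 * k - t : ℕ) : ZMod (2 * k)) + k, (add_half_mem_intervalSet hk _).2 hx', ?_⟩
    rw [e, add_half_mem_intervalSet hk, not_not]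
    exact hx

theorem intervalSet_sub_compl {k : ℕ} (hk : 2 ≤ k) :
    intervalSet k - (intervalSet k)ᶜ = {0}ᶜ := by
  ext d
  rw [Set.mem_sub, Set.mem_compl_singleton_iff]
  constructor
  · rintro ⟨x, hx, y, hy, rfl⟩ h
    rw [sub_eq_zero] at h
    exact hy (h ▸ hx)
  · intro hd
    obtain ⟨x, hx, hx'⟩ := exists_add_notMem hk (neg_ne_zero.2 hd)
    exact ⟨x, hx, x + -d, hx', by ring⟩

/-- A residue `u` missed by the sumset gives one inclusion; both sides have equal size. -/
theorem smul_compl_eq_sub_compl {k : ℕ} (hk : 2 ≤ k) {v : ZMod (2 * k)} (hv : IsUnit v)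
    (h : intervalSet k + v • (intervalSet k)ᶜ ≠ Set.univ) :
    ∃ u : ZMod (2 * k), v • (intervalSet k)ᶜ = {u} - (intervalSet k)ᶜ := by
  have : NeZero (2 * k) := ⟨by omega⟩
  obtain ⟨u, hu⟩ := (Set.ne_univ_iff_exists_notMem _).1 h
  refine ⟨u, ?_⟩
  have hsub : {u} - (intervalSet k)ᶜ = (fun x => u - x) '' (intervalSet k)ᶜ := by
    rw [Set.singleton_sub]
  have hsmul : v • (intervalSet k)ᶜ = (fun x => v * x) '' (intervalSet k)ᶜ := rfl
  refine Set.eq_of_subset_of_ncard_le ?_ ?_ (Set.toFinite _)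
  · intro y hy
    rw [hsub]
    refine ⟨u - y, fun h' => hu ?_, by ring⟩
    exact ⟨u - y, h', y, hy, by ring⟩
  · rw [hsub, hsmul, Set.ncard_image_of_injective _ (sub_right_injective),
      Set.ncard_image_of_injective _ hv.mul_right_injective]

/-! ### Runs of `A` and affine rigidity. -/

/-- The last elements of the three runs of `A`. -/
theorem eq_of_add_one_notMem {k : ℕ} (hk : 4 ≤ k) {x : ZMod (2 * k)} (hx : x ∈ intervalSet k)
    (hx' : x + 1 ∉ intervalSet k) :
    x = ((1 : ℕ) : ZMod (2 * k)) ∨ x = ((k - 1 : ℕ) : ZMod (2 * k)) ∨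
      x = ((k + 2 : ℕ) : ZMod (2 * k)) := by
  obtain ⟨m, hm, rfl⟩ := exists_natCast_lt (by omega) x
  rw [natCast_mem_intervalSet (by omega) (by omega)] at hx
  rw [← Nat.cast_one, ← Nat.cast_add, natCast_mem_intervalSet (by omega) (by omega)] at hx'
  have : m = 1 ∨ m = k - 1 ∨ m = k + 2 := by omega
  rcases this with rfl | rfl | rfl <;> simp

/-- The first elements of the three runs of `A`. -/
theorem eq_of_sub_one_notMem {k : ℕ} (hk : 4 ≤ k) {x : ZMod (2 * k)} (hx : x ∈ intervalSet k)
    (hx' : x - 1 ∉ intervalSet k) :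
    x = ((0 : ℕ) : ZMod (2 * k)) ∨ x = ((3 : ℕ) : ZMod (2 * k)) ∨
      x = ((k + 2 : ℕ) : ZMod (2 * k)) := by
  obtain ⟨m, hm, rfl⟩ := exists_natCast_lt (by omega) x
  rw [natCast_mem_intervalSet (by omega) (by omega)] at hx
  rw [← Nat.cast_one, natCast_sub_mem_intervalSet (by omega),
    natCast_mem_intervalSet (by omega) (by omega)] at hx'
  have : m = 0 ∨ m = 3 ∨ m = k + 2 := by omega
  rcases this with rfl | rfl | rfl <;> simp

/-- For `k = 4` the run `3, …, k - 1` is also a single point, hence `5 ≤ k`. -/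
theorem eq_of_isolated {k : ℕ} (hk : 5 ≤ k) {x : ZMod (2 * k)} (hx : x ∈ intervalSet k)
    (hx₁ : x + 1 ∉ intervalSet k) (hx₂ : x - 1 ∉ intervalSet k) :
    x = ((k + 2 : ℕ) : ZMod (2 * k)) := by
  rcases eq_of_add_one_notMem (by omega) hx hx₁ with h | h | h
  · rcases eq_of_sub_one_notMem (by omega) hx hx₂ with h' | h' | h'
    · have := natCast_inj_of_lt (by omega) (by omega) (h.symm.trans h'); omega
    · have := natCast_inj_of_lt (by omega) (by omega) (h.symm.trans h'); omega
    · exact h'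
  · rcases eq_of_sub_one_notMem (by omega) hx hx₂ with h' | h' | h'
    · have := natCast_inj_of_lt (by omega) (by omega) (h.symm.trans h'); omega
    · have := natCast_inj_of_lt (by omega) (by omega) (h.symm.trans h'); omega
    · exact h'
  · exact h

theorem isolated_half_add_two {k : ℕ} (hk : 5 ≤ k) :
    ((k + 2 : ℕ) : ZMod (2 * k)) ∈ intervalSet k ∧
    ((k + 2 : ℕ) : ZMod (2 * k)) + 1 ∉ intervalSet k ∧
    ((k + 2 : ℕ) : ZMod (2 * k)) - 1 ∉ intervalSet k := by
  refine ⟨?_, ?_, ?_⟩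
  · rw [natCast_mem_intervalSet (by omega) (by omega)]; omega
  · rw [← Nat.cast_one, ← Nat.cast_add, natCast_mem_intervalSet (by omega) (by omega)]; omega
  · rw [← Nat.cast_one, natCast_sub_mem_intervalSet (by omega),
      natCast_mem_intervalSet (by omega) (by omega)]
    omega

/-- A step `t ∈ [5, k - 1]` leaves `A` from at least four elements. -/
theorem not_forall_add_natCast_mem_or_eq {k t : ℕ} (hk : 8 ≤ k) (ht : 5 ≤ t) (htk : t < k)
    (a b c : ZMod (2 * k)) (h : ∀ y ∈ intervalSet k, y + t ∉ intervalSet k →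
      y = a ∨ y = b ∨ y = c) : False := by
  classical
  -- These points lie in `A` since `k - 5 ≥ 3`, and `+t` sends them into `[k, 2k - 2]`, where `A`
  -- has only `k + 2`.
  let S := (Finset.Icc (k - 5) (k - 1)).erase (k + 2 - t)
  have hS : 4 ≤ S.card := by
    have := Finset.pred_card_le_card_erase (s := Finset.Icc (k - 5) (k - 1)) (a := k + 2 - t)
    rw [Nat.card_Icc] at this
    change 4 ≤ ((Finset.Icc (k - 5) (k - 1)).erase (k + 2 - t)).card
    omega
  have hsub : S.image (fun m : ℕ => (m : ZMod (2 * k))) ⊆ {a, b, c} := by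
    intro y hy
    obtain ⟨m, hm, rfl⟩ := Finset.mem_image.1 hy
    rw [Finset.mem_erase, Finset.mem_Icc] at hm
    rw [Finset.mem_insert, Finset.mem_insert, Finset.mem_singleton]
    refine h m ?_ ?_
    · rw [natCast_mem_intervalSet (by omega) (by omega)]; omega
    · rw [← Nat.cast_add, natCast_mem_intervalSet (by omega) (by omega)]; omega
  have hcard := Finset.card_le_card hsub
  rw [Finset.card_image_of_injOn] at hcard
  · have := Finset.card_le_three (a := a) (b := b) (c := c)
    omega
  · intro m hm m' hm' e
    rw [Finset.mem_coe, Finset.mem_erase, Finset.mem_Icc] at hm hm'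
    exact natCast_inj_of_lt (by omega) (by omega) e

/-- The symmetry conjugates `+1` to `+w`, so run ends map to the points that `+w` moves out of `A`;
for `w = -t`, run starts and `-1` are used. -/
theorem step_lt_five {k t : ℕ} (hk : 8 ≤ k) {w u : ZMod (2 * k)} (hw : IsUnit w)
    (h : ∀ x, w * x + u ∈ intervalSet k ↔ x ∈ intervalSet k) (htk : t < k)
    (hwt : w = t ∨ w = -t) : t < 5 := by
  by_contra! ht
  have hsurj : ∀ y, ∃ x, w * x + u = y := fun y => by
    obtain ⟨w, rfl⟩ := hw
    exact ⟨(w⁻¹ : (ZMod (2 * k))ˣ) * (y - u), by rw [Units.mul_inv_cancel_left]; ring⟩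
  rcases hwt with e | e
  · refine not_forall_add_natCast_mem_or_eq hk ht htk (w * (1 : ℕ) + u) (w * (k - 1 : ℕ) + u)
      (w * (k + 2 : ℕ) + u) fun y hy hy' => ?_
    obtain ⟨x, rfl⟩ := hsurj y
    rw [← e, show w * x + u + w = w * (x + 1) + u by ring, h] at hy'
    rw [h] at hy
    rcases eq_of_add_one_notMem (by omega) hy hy' with rfl | rfl | rfl <;> simp
  · refine not_forall_add_natCast_mem_or_eq hk ht htk (w * (0 : ℕ) + u) (w * (3 : ℕ) + u)
      (w * (k + 2 : ℕ) + u) fun y hy hy' => ?_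
    obtain ⟨x, rfl⟩ := hsurj y
    rw [show (t : ZMod (2 * k)) = -w by rw [e, neg_neg],
      show w * x + u + -w = w * (x - 1) + u by ring, h] at hy'
    rw [h] at hy
    rcases eq_of_sub_one_notMem (by omega) hy hy' with rfl | rfl | rfl <;> simp

theorem not_isUnit_of_mul_half_eq_zero {k : ℕ} (hk : 1 ≤ k) {w : ZMod (2 * k)}
    (h : w * k = 0) : ¬ IsUnit w := fun hw => by
  have := natCast_inj_of_lt (n := 2 * k) (a := k) (b := 0) (by omega) (by omega)
    (by rw [Nat.cast_zero]; exact (hw.mul_right_eq_zero).1 h)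
  omega

theorem exists_eq_or_eq_neg {k : ℕ} (hk : 1 ≤ k) (w : ZMod (2 * k)) :
    ∃ t : ℕ, t ≤ k ∧ (w = t ∨ w = -t) := by
  obtain ⟨m, hm, rfl⟩ := exists_natCast_lt (by omega) w
  rcases le_or_gt m k with h | h
  · exact ⟨m, h, .inl rfl⟩
  · refine ⟨2 * k - m, by omega, .inr ?_⟩
    have h2 := natCast_two_mul_eq_zero k
    push_cast [hm.le]
    linear_combination h2

theorem eq_pm_one_or_pm_three {k : ℕ} (hk : 8 ≤ k) {w u : ZMod (2 * k)}
    (hw : IsUnit w) (h : ∀ x, w * x + u ∈ intervalSet k ↔ x ∈ intervalSet k) :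
    w = 1 ∨ w = -1 ∨ w = 3 ∨ w = -3 := by
  have h2 := natCast_two_mul_eq_zero k
  obtain ⟨t, htk, hwt⟩ := exists_eq_or_eq_neg (by omega) w
  -- An even multiplier kills `k`, so it is not a unit.
  have hne : ∀ c : ZMod (2 * k), (t : ZMod (2 * k)) = 2 * c → False := by
    intro c hc
    refine not_isUnit_of_mul_half_eq_zero (by omega) ?_ hw
    rcases hwt with e | e
    · rw [e, hc]; linear_combination c * h2
    · rw [e, hc]; linear_combination -c * h2
  rcases htk.lt_or_eq with hlt | rfl
  · have := step_lt_five hk hw h hlt hwt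
    interval_cases t
    · exact (hne 0 (by push_cast; ring)).elim
    · push_cast at hwt; tauto
    · exact (hne 1 (by push_cast; ring)).elim
    · push_cast at hwt; tauto
    · exact (hne 2 (by push_cast; ring)).elim
  · have hu : IsUnit (t : ZMod (2 * t)) := by
      rcases hwt with e | e
      · exact e ▸ hw
      · simpa [e] using hw
    have hz := (hu.mul_left_eq_zero).1 h2
    have := natCast_inj_of_lt (n := 2 * t) (a := 2) (b := 0) (by omega) (by omega) (by simpa using hz)
    omega

/-- The iterated symmetry has multiplier `w * w`, so 9 would be `±1` or `±3`; but 8, 10, 6, 12 are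
nonzero modulo `2k ≥ 16`. -/
theorem sq_ne_nine_of_preserves {k : ℕ} (hk : 8 ≤ k) {w u : ZMod (2 * k)}
    (hw : IsUnit w) (h : ∀ x, w * x + u ∈ intervalSet k ↔ x ∈ intervalSet k) :
    w * w ≠ 9 := by
  intro h9
  have hcomp : ∀ x, (w * w) * x + (w * u + u) ∈ intervalSet k ↔ x ∈ intervalSet k := fun x => by
    rw [show (w * w) * x + (w * u + u) = w * (w * x + u) + u by ring, h, h]
  have := eq_pm_one_or_pm_three hk (hw.mul hw) hcomp
  rw [h9] at this
  have aux : ∀ a : ℕ, 0 < a → a < 16 → (a : ZMod (2 * k)) ≠ 0 := fun a ha ha' e => by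
    have := natCast_inj_of_lt (n := 2 * k) (a := a) (b := 0) (by omega) (by omega) (by simpa using e)
    omega
  rcases this with e | e | e | e
  · exact aux 8 (by omega) (by omega) (by push_cast; linear_combination e)
  · exact aux 10 (by omega) (by omega) (by push_cast; linear_combination e)
  · exact aux 6 (by omega) (by omega) (by push_cast; linear_combination e)
  · exact aux 12 (by omega) (by omega) (by push_cast; linear_combination e)

/-- The only affine symmetry of `A` is the identity. -/
theorem affine_rigidity {k : ℕ} (hk : 8 ≤ k) {w u : ZMod (2 * k)} (hw : IsUnit w)
    (h : ∀ x, w * x + u ∈ intervalSet k ↔ x ∈ intervalSet k) : w = 1 ∧ u = 0 := by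
  have h2 := natCast_two_mul_eq_zero k
  obtain ⟨i₀, i₁, i₂⟩ := isolated_half_add_two (k := k) (by omega)
  have h9 := sq_ne_nine_of_preserves hk hw h
  rcases eq_pm_one_or_pm_three hk hw h with rfl | rfl | rfl | rfl
  · refine ⟨rfl, ?_⟩
    have := eq_of_isolated (by omega) ((h _).2 i₀)
      (by rwa [show ∀ c : ZMod (2 * k), 1 * c + u + 1 = 1 * (c + 1) + u by intro c; ring, h])
      (by rwa [show ∀ c : ZMod (2 * k), 1 * c + u - 1 = 1 * (c - 1) + u by intro c; ring, h])
    linear_combination this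
  · exfalso
    have := eq_of_isolated (by omega) ((h _).2 i₀)
      (by rwa [show ∀ c : ZMod (2 * k), -1 * c + u + 1 = -1 * (c - 1) + u by intro c; ring, h])
      (by rwa [show ∀ c : ZMod (2 * k), -1 * c + u - 1 = -1 * (c + 1) + u by intro c; ring, h])
    -- Fixing `k + 2` gives `u = 2k + 4 = 4`; then 5 goes to `-1`, outside `A`.
    have hu : u = 4 := by push_cast at this; linear_combination this + h2
    have h5 : ((5 : ℕ) : ZMod (2 * k)) ∈ intervalSet k := by
      rw [natCast_mem_intervalSet (by omega) (by omega)]; omega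
    rw [← h, hu, show -1 * ((5 : ℕ) : ZMod (2 * k)) + 4 = (0 : ℕ) - (1 : ℕ) by push_cast; ring,
      natCast_sub_mem_intervalSet (by omega),
      natCast_mem_intervalSet (by omega) (by omega)] at h5
    omega
  · exact (h9 (by norm_num)).elim
  · exact (h9 (by norm_num)).elim

/-! ### Symmetries and the unique polarity. -/

theorem neg_smul_add_ne {k : ℕ} (hk : 8 ≤ k) {v : ZMod (2 * k)} (hv : IsUnit v) (hv1 : v ≠ -1)
    (u : ZMod (2 * k)) : (-v) • intervalSet k + {u} ≠ intervalSet k := by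
  intro h
  have := affine_rigidity (u := u) hk hv.neg fun x => by
    nth_rw 1 [← h]
    rw [Set.add_singleton]
    constructor
    · rintro ⟨_, ⟨y, hy, rfl⟩, e⟩
      have e' : -v * y = -v * x := add_right_cancel e
      rwa [← hv.neg.mul_left_cancel e']
    · intro hx
      exact ⟨_, ⟨x, hx, rfl⟩, rfl⟩
  exact hv1 (neg_eq_iff_eq_neg.1 this.1)

theorem isUnit_of_affine_perm {n : ℕ} {g : Equiv.Perm (ZMod n)} {u v : ZMod n}
    (hg : ∀ x, g x = v * x + u) : IsUnit v := by
  obtain ⟨x, hx⟩ := g.surjective (1 + u)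
  rw [hg] at hx
  exact IsUnit.of_mul_eq_one x (add_right_cancel hx)

theorem affine_perm_eq_one {k : ℕ} (hk : 8 ≤ k) {g : Equiv.Perm (ZMod (2 * k))}
    (hg : g ∈ affineBijections (2 * k)) (h : g '' intervalSet k = intervalSet k) : g = 1 := by
  obtain ⟨u, v, huv⟩ := hg
  obtain ⟨rfl, rfl⟩ := affine_rigidity hk (isUnit_of_affine_perm huv) (u := u) fun x => by
    rw [← huv]
    nth_rw 1 [← h]
    exact g.injective.mem_set_image
  ext x
  simp [huv]

theorem inv_mul_mem_affineBijections {n : ℕ} {p q : Equiv.Perm (ZMod n)}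
    (hp : p ∈ affineBijections n) (hq : q ∈ affineBijections n) :
    q⁻¹ * p ∈ affineBijections n := by
  obtain ⟨u, v, hp⟩ := hp
  obtain ⟨u', v', hq⟩ := hq
  obtain ⟨v', rfl⟩ := isUnit_of_affine_perm hq
  refine ⟨(v'⁻¹ : (ZMod n)ˣ) * (u - u'), (v'⁻¹ : (ZMod n)ˣ) * v, fun x => ?_⟩
  rw [Equiv.Perm.mul_apply, Equiv.Perm.inv_eq_iff_eq, hp, hq]
  linear_combination (-(v * x) - (u - u')) * v'.mul_inv

theorem image_eq_compl_of_union_eq_univ {k : ℕ} (hk : 2 ≤ k) {p : Equiv.Perm (ZMod (2 * k))}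
    (h : intervalSet k ∪ p '' intervalSet k = Set.univ) :
    p '' intervalSet k = (intervalSet k)ᶜ := by
  have : NeZero (2 * k) := ⟨by omega⟩
  refine (Set.eq_of_subset_of_ncard_le (fun x hx => ?_) ?_ (Set.toFinite _)).symm
  · exact ((h.symm ▸ Set.mem_univ x : x ∈ intervalSet k ∪ p '' intervalSet k)).resolve_left hx
  · rw [ncard_compl_intervalSet hk, Set.ncard_image_of_injective _ p.injective]

theorem isCounterpointDichotomy_intervalSet {k : ℕ} (hk : 8 ≤ k) :
    IsCounterpointDichotomy (intervalSet k) := by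
  refine ⟨fun g hg hne h => hne (affine_perm_eq_one hk hg h),
    Equiv.addRight (k : ZMod (2 * k)), ⟨⟨k, 1, fun x => by simp⟩, ?_⟩, ?_⟩
  · have := image_add_half_intervalSet (k := k) (by omega)
    rw [Equiv.coe_addRight, this, Set.union_compl_self]
  · rintro p ⟨hp, hpA⟩
    have hq : Equiv.addRight (k : ZMod (2 * k)) ∈ affineBijections (2 * k) :=
      ⟨k, 1, fun x => by simp⟩
    -- Both `p` and the half-turn send `A` onto its complement, so their quotient is a symmetry.
    have e := affine_perm_eq_one hk (inv_mul_mem_affineBijections hp hq) <| by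
      rw [Equiv.Perm.coe_mul, Set.image_comp, image_eq_compl_of_union_eq_univ (by omega) hpA,
        ← image_add_half_intervalSet (by omega), ← Equiv.coe_addRight, ← Set.image_comp,
        ← Equiv.Perm.coe_mul, inv_mul_cancel, Equiv.Perm.coe_one, Set.image_id]
    exact (inv_mul_eq_one.1 e).symm

theorem mainTheorem2 (k : ℕ) (hk : 2 ≤ k) :
    intervalSet k - (intervalSet k)ᶜ = {0}ᶜ ∧
    (∀ v : ZMod (2 * k), IsUnit v → intervalSet k + v • (intervalSet k)ᶜ ≠ Set.univ →
      ∃ u : ZMod (2 * k), v • (intervalSet k)ᶜ = {u} - (intervalSet k)ᶜ) ∧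
    (8 ≤ k →
      (∀ v : ZMod (2 * k), IsUnit v → v ≠ -1 → ∀ u : ZMod (2 * k),
        (-v) • intervalSet k + {u} ≠ intervalSet k) ∧
      IsCounterpointDichotomy (intervalSet k)) :=
  ⟨intervalSet_sub_compl hk, fun _ hv h => smul_compl_eq_sub_compl hk hv h, fun h8 =>
    ⟨fun _ hv hv1 u => neg_smul_add_ne h8 hv hv1 u, isCounterpointDichotomy_intervalSet h8⟩⟩
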